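/- Let $X$ be a compact metrizable space and let $\mathcal P(X)$ be the space of Borel probability measures on $X$ with the weak topology. For $N\ge 1$ let $H^{(N)}:X^N\to\,]-\infty,\infty]$ be a symmetric Borel measurable function, let $\delta_N(x_1,\dots,x_N)=\frac1N\sum_{i=1}^N\delta_{x_i}\in\mathcal P(X)$, and for a probability measure $\mu^{(N)}$ on $X^N$ put $E^{(N)}(\mu^{(N)})=\frac1N\int_{X^N}H^{(N)}\,d\mu^{(N)}$. Integrals of functions with values in $[-\infty,\infty]$ are $\int f^+-\int f^-$, with $\infty-\infty:=-\infty$. Let $\mu_0\in\mathcal P(X)$ and $E:\mathcal P(X)\to\,]-\infty,\infty]$. Consider the hypotheses: - (H1) $\lim_{N\to\infty}E^{(N)}(\mu^{\otimes N})=E(\mu)$ for every $\mu\in\mathcal P(X)$ with $E(\mu)<\infty$; moreover $E(\mu_0)<\infty$. - (H2) For every sequence of symmetric (i.e. permutation invariant) probability measures $\mu^{(N)}$ on $X^N$ such that $(\delta_N)_*\mu^{(N)}$ converges weakly to some $\Gamma\in\mathcal P(\mathcal P(X))$, one has $\liminf_{N\to\infty}E^{(N)}(\mu^{(N)})\ge\int_{\mathcal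 P(X)}E\,d\Gamma$. - (H3) For every $\mu$ with $E(\mu)<\infty$ there is a sequence $\mu_j\to\mu$ weakly with $\mu_j$ absolutely continuous with respect to $\mu_0$ and $E(\mu_j)\to E(\mu)$. View $H^{(N)}/N$ as a functional on $\mathcal P(X)$ by giving it the value $H^{(N)}(x)/N$ at $\delta_N(x)$, $x\in X^N$, and the value $\infty$ at all measures that are not of this form. A sequence of functions $f_N$ on a topological space Gamma-converges to $f$ if $\liminf_N f_N(x_N)\ge f(x)$ whenever $x_N\to x$, and every point $x$ is the limit of a sequence $x_N$ with $f_N(x_N)\to f(x)$. (i) If H1, H2 and H3 hold, then $H^{(N)}/N$ Gamma-converges to $E$ on $\mathcal P(X)$. (ii) In particular this applies to finite order mean field Hamiltonians: let $M\ge0$, let $W_m:X^m\to\,]-\infty,\infty]$ be symmetric and lower semicontinuous for $1\le m\le M$, and put $$H^{(N)}(x_1,\dots,x_N)=\sum_{m=1}^M\frac1{N^{m-1}}\sum_{I}W_m(x_{i_1},\dots,x_{i_m}),\qquad E(\mu)=\sum_{m=1}^M\int_{X^m}W_m\,d\mu^{\otimes m},$$ where $I=(i_1,\dots,i_m)$ runs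 over the multi-indices in $\{1,\dots,N\}^m$ with pairwise distinct entries. Then H2 holds, H1 holds if $E(\mu_0)<\infty$, and if H3 holds, then $H^{(N)}/N$ Gamma-converges to $E$ on $\mathcal P(X)$. -/

import Mathlib

open MeasureTheory Filter Topology
open scoped ENNReal NNReal

namespace MeanEnergy

/-! ### Measure-theoretic preliminaries

`ProbabilityMeasure X` is the space of Borel probability measures on `X`; Mathlib gives it the
weak topology and the sigma-algebra generated by the evaluations `μ ↦ μ s`. To speak of weak
convergence of probability measures on `ProbabilityMeasure X` one needs that this sigma-algebra is
the Borel sigma-algebra of the weak topology, which is proved here when `X` is compact and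
metrizable. -/

section Borel

variable {X : Type*} [TopologicalSpace X] [CompactSpace X] [TopologicalSpace.MetrizableSpace X]
  [MeasurableSpace X] [BorelSpace X]

theorem secondCountable_probabilityMeasure :
    SecondCountableTopology (ProbabilityMeasure X) := by
  let : MetricSpace X := TopologicalSpace.metrizableSpaceMetric X
  have : TopologicalSpace.SeparableSpace X := inferInstance
  let : MetricSpace (ProbabilityMeasure X) :=
    TopologicalSpace.metrizableSpaceMetric (ProbabilityMeasure X)
  infer_instance

instance instBorelSpaceProbabilityMeasure : BorelSpace (ProbabilityMeasure X) := by
  have := secondCountable_probabilityMeasure (X := X)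
  refine ⟨le_antisymm ?_ ?_⟩
  · -- every evaluation is Borel measurable
    let : MetricSpace X := TopologicalSpace.metrizableSpaceMetric X
    have key : @Measurable (ProbabilityMeasure X) (Measure X) (borel _) _
        (fun μ => (μ : Measure X)) := by
      refine @Measurable.measure_of_isPiSystem_of_isProbabilityMeasure
        (ProbabilityMeasure X) X (borel _) _ (fun μ => (μ : Measure X)) (fun μ => inferInstance)
        {s | IsClosed s} ?_ ?_ ?_
      · rw [← borel_eq_generateFrom_isClosed]; exact BorelSpace.measurable_eq
      · exact isPiSystem_isClosed
      · intro F hF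
        have hF : IsClosed F := hF
        refine @measurable_of_tendsto_metrizable' (ProbabilityMeasure X) ℝ≥0∞ (borel _) _ _ _ _ _
          (fun (n : ℕ) (μ : ProbabilityMeasure X) => ∫⁻ x, hF.apprSeq n x ∂(μ : Measure X)) _
          atTop _ _ ?_ ?_
        · intro n
          have hc : Continuous fun μ : ProbabilityMeasure X =>
              ∫⁻ x, hF.apprSeq n x ∂(μ : Measure X) :=
            ProbabilityMeasure.continuous_iff_forall_continuous_lintegral.1 continuous_id _
          exact @measurable_of_isOpen _ _ _ _ _ (borel _) _ fun v hv =>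
            MeasurableSpace.measurableSet_generateFrom (hv.preimage hc)
        · rw [tendsto_pi_nhds]
          intro μ
          exact HasOuterApproxClosed.tendsto_lintegral_apprSeq hF (μ : Measure X)
    exact key.comap_le
  · -- weakly open sets are measurable for the sigma-algebra generated by the evaluations
    let G : Set (Set (ProbabilityMeasure X)) :=
      {u | ∃ (f : BoundedContinuousFunction X ℝ≥0) (v : Set ℝ≥0∞), IsOpen v ∧
        (fun μ : ProbabilityMeasure X => ∫⁻ x, f x ∂(μ : Measure X)) ⁻¹' v = u}
    have hG : (inferInstance : TopologicalSpace (ProbabilityMeasure X)) = .generateFrom G := by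
      refine le_antisymm (le_generateFrom ?_) ?_
      · rintro u ⟨f, v, hv, rfl⟩
        exact hv.preimage
          (ProbabilityMeasure.continuous_iff_forall_continuous_lintegral.1 continuous_id f)
      · refine continuous_id_iff_le.1 ?_
        refine (@ProbabilityMeasure.continuous_iff_forall_continuous_lintegral X _ _ _
          (ProbabilityMeasure X) (.generateFrom G) id).2 fun f => ?_
        exact @Continuous.mk _ _ (.generateFrom G) _ _ fun v hv => .basic _ ⟨f, v, hv, rfl⟩
    rw [borel_eq_generateFrom_of_subbasis hG]
    refine MeasurableSpace.generateFrom_le ?_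
    rintro u ⟨f, v, hv, rfl⟩
    refine (Measurable.comp (g := fun μ : Measure X => ∫⁻ x, f x ∂μ)
      (Measure.measurable_lintegral ?_) measurable_subtype_coe) hv.measurableSet
    exact (ENNReal.continuous_coe.comp f.continuous).measurable

end Borel

noncomputable section

/-- The integral `∫ f⁺ dμ - ∫ f⁻ dμ` of a function with values in `[-∞, ∞]`. By the conventions of
`EReal`, the ill-defined case `∞ - ∞` has the value `-∞`. -/
def integralEReal {Z : Type*} [MeasurableSpace Z] (μ : Measure Z) (f : Z → EReal) : EReal :=
  ((∫⁻ z, (f z).toENNReal ∂μ : ℝ≥0∞) : EReal) - ((∫⁻ z, (-f z).toENNReal ∂μ : ℝ≥0∞) : EReal)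

/-- Sequential Gamma-convergence of a sequence of functions on a topological space. -/
def GammaConverges {𝒳 : Type*} [TopologicalSpace 𝒳] (f : ℕ+ → 𝒳 → EReal) (g : 𝒳 → EReal) : Prop :=
  (∀ (x : ℕ+ → 𝒳) (a : 𝒳), Tendsto x atTop (𝓝 a) →
    g a ≤ liminf (fun j => f j (x j)) atTop) ∧
  ∀ a : 𝒳, ∃ x : ℕ+ → 𝒳, Tendsto x atTop (𝓝 a) ∧ Tendsto (fun j => f j (x j)) atTop (𝓝 (g a))

section Empirical

variable {X : Type*} [MeasurableSpace X]

/-- The empirical measure `N⁻¹ ∑ᵢ δ_{xᵢ}` of a configuration of `N ≥ 1` points. -/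
def empirical (N : ℕ+) (x : Fin N → X) : ProbabilityMeasure X :=
  ⟨((N : ℕ) : ℝ≥0∞)⁻¹ • ∑ i, Measure.dirac (x i), ⟨by
    simp [ENNReal.inv_mul_cancel (show ((N : ℕ) : ℝ≥0∞) ≠ 0 by simp) (by simp)]⟩⟩

theorem measurable_empirical (N : ℕ+) :
    Measurable (empirical N : (Fin N → X) → ProbabilityMeasure X) := by
  refine Measurable.subtype_mk (Measure.measurable_of_measurable_coe _ fun s hs => ?_)
  simp only [Measure.smul_apply, Measure.finsetSum_apply, smul_eq_mul]
  refine Measurable.const_mul (Finset.measurable_sum _ fun i _ => ?_) _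
  exact ((Measure.measurable_coe hs).comp Measure.measurable_dirac).comp (measurable_pi_apply i)

/-- The law of the empirical measure when the configuration has law `μ`. -/
def empiricalLaw (N : ℕ+) (μ : ProbabilityMeasure (Fin N → X)) :
    ProbabilityMeasure (ProbabilityMeasure X) :=
  μ.map (measurable_empirical N).aemeasurable

/-- The `N`-fold product measure `μ^{⊗N}`. -/
def tensorPower (μ : ProbabilityMeasure X) (N : ℕ) : ProbabilityMeasure (Fin N → X) :=
  ProbabilityMeasure.pi fun _ => μ

/-- Invariance of a probability measure on `X^N` under permutations of the coordinates. -/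
def IsSymmetricLaw {N : ℕ} (μ : ProbabilityMeasure (Fin N → X)) : Prop :=
  ∀ σ : Equiv.Perm (Fin N), (μ : Measure (Fin N → X)).map (fun x => x ∘ σ) = μ

/-- A sequence of Hamiltonians: symmetric measurable functions `X^N → ]-∞, ∞]`, `N ≥ 1`. -/
structure IsHamiltonian (H : (N : ℕ+) → (Fin N → X) → EReal) : Prop where
  ne_bot : ∀ N x, H N x ≠ ⊥
  symmetric : ∀ (N : ℕ+) (σ : Equiv.Perm (Fin N)) (x : Fin N → X), H N (x ∘ σ) = H N x
  measurable : ∀ N, Measurable (H N)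

/-- The mean energy `E^{(N)}(μ) = N⁻¹ ∫ H^{(N)} dμ` of a probability measure on `X^N`. -/
def meanEnergy (H : (N : ℕ+) → (Fin N → X) → EReal) (N : ℕ+) (μ : ProbabilityMeasure (Fin N → X)) :
    EReal :=
  integralEReal (μ : Measure (Fin N → X)) (H N) / (((N : ℕ) : ℝ) : EReal)

/-- `H^{(N)}/N` viewed as a functional on the space of probability measures: its value at an
empirical measure `δ_N(x)` is `H^{(N)}(x)/N` (see `scaledHamiltonian_empirical`; the infimum is over
the permutations of one configuration), and its value at all other measures is `∞`. -/
def scaledHamiltonian (H : (N : ℕ+) → (Fin N → X) → EReal) (N : ℕ+) (ν : ProbabilityMeasure X) :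
    EReal :=
  ⨅ (x : Fin N → X) (_ : empirical N x = ν), H N x / (((N : ℕ) : ℝ) : EReal)

theorem exists_perm_of_empirical_eq [MeasurableSingletonClass X] {N : ℕ+} {x y : Fin N → X}
    (h : empirical N x = empirical N y) : ∃ σ : Equiv.Perm (Fin N), y ∘ σ = x := by
  classical
  have key : ∀ a : X, Nonempty ({i // x i = a} ≃ {i // y i = a}) := by
    intro a
    have h1 : ((empirical N x : ProbabilityMeasure X) : Measure X) {a}
        = ((empirical N y : ProbabilityMeasure X) : Measure X) {a} := by rw [h]
    have hc : ∀ z : Fin N → X, ((empirical N z : ProbabilityMeasure X) : Measure X) {a}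
        = ((N : ℕ) : ℝ≥0∞)⁻¹ * (Fintype.card {i // z i = a} : ℝ≥0∞) := by
      intro z
      simp [empirical, Set.indicator_apply, Fintype.card_subtype]
    rw [hc, hc, ENNReal.mul_right_inj (by simp) (by simp)] at h1
    exact Fintype.card_eq.1 (by exact_mod_cast h1)
  let e : ∀ a : X, {i // x i = a} ≃ {i // y i = a} := fun a => (key a).some
  exact ⟨Equiv.ofFiberEquiv e, funext fun i => Equiv.ofFiberEquiv_map e i⟩

theorem scaledHamiltonian_empirical [MeasurableSingletonClass X]
    {H : (N : ℕ+) → (Fin N → X) → EReal} (hH : IsHamiltonian H) (N : ℕ+) (x : Fin N → X) :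
    scaledHamiltonian H N (empirical N x) = H N x / (((N : ℕ) : ℝ) : EReal) := by
  refine le_antisymm (iInf₂_le (f := fun (y : Fin N → X)
    (_ : empirical N y = empirical N x) => H N y / (((N : ℕ) : ℝ) : EReal)) x rfl) (le_iInf₂ fun y hy => ?_)
  obtain ⟨σ, rfl⟩ := exists_perm_of_empirical_eq hy
  rw [hH.symmetric]

/-- Hypothesis (H1): `E` is a functional with values in `]-∞, ∞]` which is the macroscopic mean
energy of all `μ` with `E μ < ∞`, and `E μ₀ < ∞`. -/
structure H1 (H : (N : ℕ+) → (Fin N → X) → EReal) (E : ProbabilityMeasure X → EReal)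
    (μ₀ : ProbabilityMeasure X) : Prop where
  ne_bot : ∀ μ, E μ ≠ ⊥
  tendsto : ∀ μ, E μ < ⊤ →
    Tendsto (fun N : ℕ+ => meanEnergy H N (tensorPower μ N)) atTop (𝓝 (E μ))
  reference_finite : E μ₀ < ⊤

/-- The finite order mean field Hamiltonian
`H^{(N)}(x) = ∑_{m=1}^M N^{-(m-1)} ∑_I W_m(x_{i_1}, …, x_{i_m})`, where `I` runs over all ordered
multi-indices of length `m` without repetitions, i.e. over the injections `Fin m ↪ Fin N`. -/
def meanFieldHamiltonian (M : ℕ) (W : (m : ℕ) → (Fin m → X) → EReal) (N : ℕ+) (x : Fin N → X) :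
    EReal :=
  ∑ m ∈ Finset.Icc 1 M, (((((N : ℕ) : ℝ) ^ (m - 1))⁻¹ : ℝ) : EReal) *
    ∑ I : Fin m ↪ Fin N, W m (fun k => x (I k))

/-- The mean field energy `E(μ) = ∑_{m=1}^M ∫ W_m dμ^{⊗m}`. -/
def meanFieldEnergy (M : ℕ) (W : (m : ℕ) → (Fin m → X) → EReal) (μ : ProbabilityMeasure X) :
    EReal :=
  ∑ m ∈ Finset.Icc 1 M, integralEReal (tensorPower μ m : Measure (Fin m → X)) (W m)

end Empirical

section Hypotheses

variable {X : Type*} [TopologicalSpace X] [CompactSpace X] [TopologicalSpace.MetrizableSpace X]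
  [MeasurableSpace X] [BorelSpace X]

/-- Hypothesis (H2), the lower bound on the mean energy: whenever symmetric laws `μ^{(N)}` on `X^N`
are such that the laws of the empirical measures converge weakly to a probability measure `Γ` on
the space of probability measures, `liminf E^{(N)}(μ^{(N)}) ≥ ∫ E dΓ`. -/
def H2 (H : (N : ℕ+) → (Fin N → X) → EReal) (E : ProbabilityMeasure X → EReal) : Prop :=
  ∀ (μ : (N : ℕ+) → ProbabilityMeasure (Fin N → X)) (Γ : ProbabilityMeasure (ProbabilityMeasure X)),
    (∀ N, IsSymmetricLaw (μ N)) →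
    Tendsto (fun N => empiricalLaw N (μ N)) atTop (𝓝 Γ) →
    integralEReal (Γ : Measure (ProbabilityMeasure X)) E
      ≤ liminf (fun N => meanEnergy H N (μ N)) atTop

/-- Hypothesis (H3), the approximation property. -/
def H3 (E : ProbabilityMeasure X → EReal) (μ₀ : ProbabilityMeasure X) : Prop :=
  ∀ μ, E μ < ⊤ → ∃ ν : ℕ → ProbabilityMeasure X, Tendsto ν atTop (𝓝 μ) ∧
    (∀ j, (ν j : Measure X) ≪ (μ₀ : Measure X)) ∧ Tendsto (fun j => E (ν j)) atTop (𝓝 (E μ))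

end Hypotheses

end

end MeanEnergy

/-! Lower bound. For a configuration `z`, the uniform law on its permutations is symmetric, its
empirical law is a Dirac mass at `empirical N z`, and its mean energy is `H N z / N`. If the
empirical measures converge to `a`, (H2) with Γ the Dirac mass at `a` is therefore exactly the
liminf inequality. Measures that are not empirical carry the value `⊤` and may be replaced by
empirical measures converging to `a`, which exist by the law of large numbers.

Recovery sequence. Suppose `E a < c` and H^{(N)}/N ≥ c on a neighbourhood of `a`. The product law of
`a` puts all but vanishing mass on configurations with empirical measure in that neighbourhood. On
the rest H^{(N)}/N is bounded below uniformly in N, by the liminf inequality and compactness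
(`exists_forall_le_scaledHamiltonian`). So the mean energies of the product laws exceed every number
below `c` in the limit, against (H1). Hence values below `c` occur near `a`; with the lower bound,
made uniform near `a`, a diagonal extraction gives the sequence.

Mean field case. For (H1), each injective multi-index sees the law μ^{⊗m}, so the mean energy of
μ^{⊗N} is the energy with the m-th term weighted by the proportion of injective multi-indices, which
tends to 1. For (H2), continuous interactions make H^{(N)}/N uniformly close to a weakly continuous
functional of the empirical measure; lower semicontinuous ones are increasing limits of continuous
ones, and monotone convergence finishes. -/

namespace MeanEnergy

/-! ### Integrals of extended real functions -/

section IntegralEReal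

variable {Z : Type*} [MeasurableSpace Z] {μ : Measure Z}

theorem integralEReal_mono {f g : Z → EReal} (h : f ≤ g) :
    integralEReal μ f ≤ integralEReal μ g := by
  refine EReal.sub_le_sub ?_ ?_
  · exact EReal.coe_ennreal_le_coe_ennreal_iff.2
      (lintegral_mono fun z => EReal.toENNReal_le_toENNReal (h z))
  · exact EReal.coe_ennreal_le_coe_ennreal_iff.2
      (lintegral_mono fun z => EReal.toENNReal_le_toENNReal (EReal.neg_le_neg_iff.2 (h z)))

theorem integralEReal_congr_ae {f g : Z → EReal} (h : f =ᵐ[μ] g) :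
    integralEReal μ f = integralEReal μ g := by
  unfold integralEReal
  congr 2
  · exact lintegral_congr_ae (h.mono fun z hz => by simp only [hz])
  · exact lintegral_congr_ae (h.mono fun z hz => by simp only [hz])

theorem integralEReal_coe {f : Z → ℝ} (hf : Integrable f μ) :
    integralEReal μ (fun z => (f z : EReal)) = ((∫ z, f z ∂μ : ℝ) : EReal) := by
  have hp : ∫⁻ z, ENNReal.ofReal (f z) ∂μ ≠ ⊤ := hf.lintegral_lt_top.ne
  have hn : ∫⁻ z, ENNReal.ofReal (-f z) ∂μ ≠ ⊤ := hf.neg.lintegral_lt_top.ne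
  rw [integral_eq_lintegral_pos_part_sub_lintegral_neg_part hf, EReal.coe_sub,
    EReal.coe_ennreal_toReal hp, EReal.coe_ennreal_toReal hn]
  simp only [integralEReal, ← EReal.coe_neg, EReal.real_coe_toENNReal]

theorem integralEReal_map {Y : Type*} [MeasurableSpace Y] {F : Z → Y} {g : Y → EReal}
    (hF : Measurable F) (hg : Measurable g) :
    integralEReal (μ.map F) g = integralEReal μ (fun z => g (F z)) := by
  have hg' : Measurable fun y => (-g y).toENNReal := hg.neg.ereal_toENNReal
  unfold integralEReal
  rw [lintegral_map hg.ereal_toENNReal hF, lintegral_map hg' hF]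

/-- Measurable singletons spare any measurability of `f`; this allows an arbitrary functional `E` as
integrand. -/
theorem integralEReal_dirac [MeasurableSingletonClass Z] (a : Z) (f : Z → EReal) :
    integralEReal (Measure.dirac a) f = f a := by
  simp only [integralEReal, lintegral_dirac]
  rcases le_total 0 (f a) with h | h
  · rw [EReal.coe_toENNReal h, EReal.toENNReal_of_nonpos (x := -f a) (by simpa using h)]
    simp
  · rw [EReal.coe_toENNReal (x := -f a) (by simpa using h), EReal.toENNReal_of_nonpos h]
    simp

theorem le_integralEReal_of_forall_le [IsProbabilityMeasure μ] {f : Z → EReal} {c : ℝ}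
    (h : ∀ z, (c : EReal) ≤ f z) : (c : EReal) ≤ integralEReal μ f := by
  have := integralEReal_mono (μ := μ) (f := fun _ => (c : EReal)) (g := f) h
  rw [integralEReal_coe (integrable_const c)] at this
  simpa using this

/-- A function bounded from below with finite integral agrees almost everywhere with an integrable
real-valued function. -/
theorem integrable_toReal_of_integralEReal_lt_top [IsProbabilityMeasure μ] {f : Z → EReal} {c : ℝ}
    (hf : Measurable f) (h : ∀ z, (c : EReal) ≤ f z) (hfin : integralEReal μ f < ⊤) :
    Integrable (fun z => (f z).toReal) μ ∧ f =ᵐ[μ] fun z => ((f z).toReal : EReal) := by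
  have hbot : ∀ z, f z ≠ ⊥ := fun z hz => by simpa [hz] using h z
  -- The lower bound makes the negative part finite, so an infinite positive part would give the
  -- integral the value `⊤`.
  have hn : ∫⁻ z, (-f z).toENNReal ∂μ < ⊤ := by
    refine lt_of_le_of_lt (lintegral_mono (g := fun _ => ENNReal.ofReal (-c)) fun z => ?_) (by simp)
    rw [← EReal.real_coe_toENNReal, EReal.coe_neg]
    exact EReal.toENNReal_le_toENNReal (EReal.neg_le_neg_iff.2 (h z))
  have hp : ∫⁻ z, (f z).toENNReal ∂μ < ⊤ := by
    by_contra hcon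
    rw [not_lt, top_le_iff] at hcon
    lift ∫⁻ z, (-f z).toENNReal ∂μ to ℝ≥0 using hn.ne with b hb
    rw [integralEReal, hcon, ← hb] at hfin
    exact absurd hfin (by simp [← EReal.coe_ennreal_toReal (ENNReal.coe_ne_top (r := b))])
  have hae : f =ᵐ[μ] fun z => ((f z).toReal : EReal) := by
    filter_upwards [ae_lt_top hf.ereal_toENNReal hp.ne] with z hz
    refine (EReal.coe_toReal (fun hz' => ?_) (hbot z)).symm
    simp [hz'] at hz
  refine ⟨⟨hf.ereal_toReal.aestronglyMeasurable, ?_⟩, hae⟩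
  rw [hasFiniteIntegral_iff_norm]
  have key : ∀ᵐ z ∂μ, ENNReal.ofReal ‖(f z).toReal‖ ≤ (f z).toENNReal + (-f z).toENNReal := by
    filter_upwards [hae] with z hz
    rw [hz, ← EReal.coe_neg, EReal.real_coe_toENNReal, EReal.real_coe_toENNReal, EReal.toReal_coe]
    rw [Real.norm_eq_abs]
    rcases abs_cases (f z).toReal with ⟨h1, -⟩ | ⟨h1, -⟩ <;> rw [h1] <;> simp
  refine lt_of_le_of_lt (lintegral_mono_ae key) ?_
  rw [lintegral_add_left hf.ereal_toENNReal]
  exact ENNReal.add_lt_top.2 ⟨hp, hn⟩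

/-- Monotone convergence for the positive parts, dominated convergence for the negative parts, with
dominating function the negative part of `g 0`. The limit of the latter is finite, so subtraction is
continuous at the limit. -/
theorem tendsto_integralEReal_of_monotone {f : Z → EReal} {g : ℕ → Z → ℝ}
    (hg : ∀ k, Integrable (g k) μ) (hmeas : ∀ k, Measurable (g k)) (hmono : Monotone g)
    (hlim : ∀ z, Tendsto (fun k => (g k z : EReal)) atTop (𝓝 (f z))) :
    Tendsto (fun k => ((∫ z, g k z ∂μ : ℝ) : EReal)) atTop (𝓝 (integralEReal μ f)) := by
  simp_rw [← integralEReal_coe (hg _)]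
  have hlim' : ∀ z, Tendsto (fun k => (-(g k z : EReal))) atTop (𝓝 (-f z)) := fun z =>
    (continuous_neg.tendsto _).comp (hlim z)
  have hcm : ∀ k, Measurable fun z => (g k z : EReal) := fun k => (hmeas k).coe_real_ereal
  have h1 : Tendsto (fun k => ∫⁻ z, (g k z : EReal).toENNReal ∂μ) atTop
      (𝓝 (∫⁻ z, (f z).toENNReal ∂μ)) := by
    refine lintegral_tendsto_of_tendsto_of_monotone (fun k => (hcm k).ereal_toENNReal.aemeasurable)
      (ae_of_all _ fun z j k hjk => EReal.toENNReal_le_toENNReal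
        (EReal.coe_le_coe_iff.2 (hmono hjk z)))
      (ae_of_all _ fun z => (EReal.continuous_toENNReal.tendsto _).comp (hlim z))
  have hb : ∫⁻ z, (-(g 0 z : EReal)).toENNReal ∂μ ≠ ⊤ := by
    simp_rw [← EReal.coe_neg, EReal.real_coe_toENNReal]
    exact (hg 0).neg.lintegral_lt_top.ne
  have hle : ∀ k z, (-(g k z : EReal)).toENNReal ≤ (-(g 0 z : EReal)).toENNReal := fun k z =>
    EReal.toENNReal_le_toENNReal
      (EReal.neg_le_neg_iff.2 (EReal.coe_le_coe_iff.2 (hmono (Nat.zero_le k) z)))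
  have h2 : Tendsto (fun k => ∫⁻ z, (-(g k z : EReal)).toENNReal ∂μ) atTop
      (𝓝 (∫⁻ z, (-f z).toENNReal ∂μ)) := by
    refine tendsto_lintegral_of_dominated_convergence (fun z => (-(g 0 z : EReal)).toENNReal)
      (fun k => (hcm k).neg.ereal_toENNReal) (fun k => ae_of_all _ (hle k)) hb
      (ae_of_all _ fun z => (EReal.continuous_toENNReal.tendsto _).comp (hlim' z))
  have hfin : ∫⁻ z, (-f z).toENNReal ∂μ ≠ ⊤ :=
    ne_top_of_le_ne_top hb (lintegral_mono fun z =>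
      le_of_tendsto ((EReal.continuous_toENNReal.tendsto _).comp (hlim' z))
        (Eventually.of_forall fun k => hle k z))
  unfold integralEReal
  have h2' := (continuous_neg.tendsto _).comp (EReal.tendsto_coe_ennreal.2 h2)
  have h1' := EReal.tendsto_coe_ennreal.2 h1
  simp_rw [sub_eq_add_neg]
  refine (EReal.continuousAt_add (p := (_, _)) ?_ ?_).tendsto.comp (h1'.prodMk_nhds h2')
  · right; simpa using hfin
  · left; simp

end IntegralEReal

/-! ### Diagonal extraction and locally uniform lower bounds -/

section Diagonal

/-- Diagonal extraction: sets that eventually meet every neighbourhood of `a` contain, eventually,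
the terms of a sequence converging to `a`. -/
theorem exists_tendsto_of_forall_eventually_nonempty {𝒳 : Type*} [TopologicalSpace 𝒳]
    [FirstCountableTopology 𝒳] {S : ℕ+ → Set 𝒳} {a : 𝒳}
    (h : ∀ U ∈ 𝓝 a, ∀ᶠ N in atTop, (S N ∩ U).Nonempty) :
    ∃ z : ℕ+ → 𝒳, Tendsto z atTop (𝓝 a) ∧ ∀ᶠ N in atTop, z N ∈ S N := by
  classical
  obtain ⟨U, hU⟩ := (𝓝 a).exists_antitone_basis
  let P : ℕ+ → ℕ → Prop := fun N k => (S N ∩ U k).Nonempty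
  -- The smallest basic neighbourhood, with index at most `N`, that `S N` still meets. The default
  -- value 0 is harmless because `P N 0` holds eventually.
  let κ : ℕ+ → ℕ := fun N => Nat.findGreatest (P N) N
  have hκ : ∀ᶠ N in atTop, P N (κ N) := by
    filter_upwards [h (U 0) (hU.mem 0)] with N hN
    exact Nat.findGreatest_spec (Nat.zero_le _) hN
  have hlarge : ∀ K, ∀ᶠ N in atTop, K ≤ κ N := by
    intro K
    filter_upwards [h (U K) (hU.mem K), eventually_ge_atTop (⟨K + 1, K.succ_pos⟩ : ℕ+)]
      with N hN hKN
    have hKN' : K + 1 ≤ (N : ℕ) := hKN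
    exact Nat.le_findGreatest (by omega) hN
  let z : ℕ+ → 𝒳 := fun N => if hN : P N (κ N) then hN.some else a
  refine ⟨z, hU.tendsto_right_iff.2 fun K _ => ?_, ?_⟩
  · filter_upwards [hκ, hlarge K] with N hN hKN
    simp only [z, dif_pos hN]
    exact hU.antitone hKN hN.some_mem.2
  · filter_upwards [hκ] with N hN
    simp only [z, dif_pos hN]
    exact hN.some_mem.1

/-- The sequential `liminf` inequality is uniform near each point. -/
theorem eventually_lt_of_forall_liminf {𝒳 : Type*} [TopologicalSpace 𝒳]
    [FirstCountableTopology 𝒳] {f : ℕ+ → 𝒳 → EReal} {a : 𝒳} {e c : EReal}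
    (h : ∀ x : ℕ+ → 𝒳, Tendsto x atTop (𝓝 a) → e ≤ liminf (fun j => f j (x j)) atTop)
    (hc : c < e) : ∀ᶠ p in atTop ×ˢ 𝓝 a, c < f p.1 p.2 := by
  classical
  by_contra hcon
  obtain ⟨p, hp, hpc⟩ := exists_seq_forall_of_frequently (not_eventually.1 hcon)
  simp only [not_lt] at hpc
  have hp1 : Tendsto (fun k => (p k).1) atTop atTop := tendsto_fst.comp hp
  have hp2 : Tendsto (fun k => (p k).2) atTop (𝓝 a) := tendsto_snd.comp hp
  -- The counterexamples `p k` are rearranged into one full sequence: index `N` receives a point of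
  -- some `p k` with first coordinate `N`, and `a` if there is none.
  let z : ℕ+ → 𝒳 := fun N => if hN : ∃ k, (p k).1 = N then (p hN.choose).2 else a
  have hz : Tendsto z atTop (𝓝 a) := by
    intro U hU
    obtain ⟨K, hK⟩ := eventually_atTop.1 (hp2 hU)
    -- Beyond the first coordinates of the first `K` terms, the chosen index is at least `K`.
    have hlarge : ∀ᶠ N : ℕ+ in atTop, ∀ k ∈ Finset.range K, (p k).1 < N :=
      (Finset.eventually_all _).2 fun k _ => eventually_gt_atTop _
    refine mem_map.2 ?_
    filter_upwards [hlarge] with N hN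
    by_cases hex : ∃ k, (p k).1 = N
    · simp only [z, Set.mem_preimage, dif_pos hex]
      refine hK _ ?_
      by_contra hlt
      exact (hN _ (Finset.mem_range.2 (not_le.1 hlt))).ne hex.choose_spec
    · simp only [z, Set.mem_preimage, dif_neg hex]
      exact mem_of_mem_nhds hU
  have hle : ∀ k, f (p k).1 (z (p k).1) ≤ c := by
    intro k
    have hex : ∃ k', (p k').1 = (p k).1 := ⟨k, rfl⟩
    simp only [z, dif_pos hex]
    have := hpc hex.choose
    rwa [hex.choose_spec] at this
  have hev := eventually_lt_of_lt_liminf (hc.trans_le (h z hz))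
  obtain ⟨k, hk⟩ := (hp1.eventually hev).exists
  exact absurd hk (not_lt.2 (hle k))

end Diagonal

theorem tendsto_pnat_inv : Tendsto (fun N : ℕ+ => (N : ℝ)⁻¹) atTop (𝓝 0) :=
  tendsto_inv_atTop_zero.comp (tendsto_natCast_atTop_atTop.comp tendsto_PNat_val_atTop_atTop)

/-! ### Law of large numbers for empirical measures -/

section LawOfLargeNumbers

open ProbabilityTheory

variable {X : Type*} [TopologicalSpace X] [CompactSpace X] [TopologicalSpace.MetrizableSpace X]
  [MeasurableSpace X] [BorelSpace X]

theorem integral_empirical {N : ℕ+} (x : Fin N → X) {f : X → ℝ} :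
    ∫ y, f y ∂(empirical N x : Measure X) = (N : ℝ)⁻¹ * ∑ i, f (x i) := by
  change ∫ y, f y ∂(((N : ℕ) : ℝ≥0∞)⁻¹ • ∑ i, Measure.dirac (x i)) = _
  rw [integral_smul_measure, integral_finsetSum_measure fun i _ => integrable_dirac (by simp)]
  simp

theorem integral_average_tensorPower (μ : ProbabilityMeasure X) (N : ℕ+) (f : C(X, ℝ)) :
    ∫ x, (N : ℝ)⁻¹ * ∑ i, f (x i) ∂(tensorPower μ N : Measure (Fin N → X))
      = ∫ y, f y ∂(μ : Measure X) := by
  have hf : Integrable f (μ : Measure X) := f.continuous.integrable_of_hasCompactSupport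
    (HasCompactSupport.of_compactSpace _)
  have hi : ∀ i : Fin N, MeasurePreserving (fun x : Fin N → X => x i)
      (tensorPower μ N : Measure (Fin N → X)) (μ : Measure X) := fun i =>
    measurePreserving_eval (fun _ => (μ : Measure X)) i
  have hfi : ∀ i : Fin N, Integrable (fun x : Fin N → X => f (x i))
      (tensorPower μ N : Measure (Fin N → X)) := fun i => (hi i).integrable_comp_of_integrable hf
  rw [integral_const_mul, integral_finsetSum _ fun i _ => hfi i]
  have : ∀ i : Fin N, ∫ x, f (x i) ∂(tensorPower μ N : Measure (Fin N → X))
      = ∫ y, f y ∂(μ : Measure X) := fun i => by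
    rw [← (hi i).map_eq, integral_map (hi i).measurable.aemeasurable
      f.continuous.measurable.aestronglyMeasurable]
  simp [this]

/-- Chebyshev's inequality for the empirical averages of a continuous function. -/
theorem measure_average_deviation_le (μ : ProbabilityMeasure X) (N : ℕ+) (f : C(X, ℝ)) {ε : ℝ}
    (hε : 0 < ε) :
    (tensorPower μ N : Measure (Fin N → X))
      {x | ε ≤ |(N : ℝ)⁻¹ * ∑ i, f (x i) - ∫ y, f y ∂(μ : Measure X)|}
      ≤ ENNReal.ofReal (Var[f; (μ : Measure X)] / ε ^ 2 * (N : ℝ)⁻¹) := by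
  have hf : MemLp f 2 (μ : Measure X) := f.continuous.memLp_of_hasCompactSupport
    (HasCompactSupport.of_compactSpace _)
  have hvar := variance_sum_pi (μ := fun _ : Fin N => (μ : Measure X)) (X := fun _ => f)
    fun _ => hf
  have hmem : MemLp (fun x : Fin N → X => (N : ℝ)⁻¹ * ∑ i, f (x i)) 2
      (tensorPower μ N : Measure (Fin N → X)) :=
    (memLp_finsetSum _ fun i _ =>
      hf.comp_measurePreserving (measurePreserving_eval (fun _ => (μ : Measure X)) i)).const_mul _
  have h := meas_ge_le_variance_div_sq hmem hε
  rw [integral_average_tensorPower] at h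
  refine h.trans (ENNReal.ofReal_le_ofReal (le_of_eq ?_))
  rw [variance_const_mul]
  have hsum : Var[fun x : Fin N → X => ∑ i, f (x i); (tensorPower μ N : Measure (Fin N → X))]
      = N * Var[f; (μ : Measure X)] := by
    have he : (fun x : Fin N → X => ∑ i, f (x i)) = ∑ i, fun x : Fin N → X => f (x i) := by
      ext x; simp
    rw [he]
    exact hvar.trans (by simp)
  rw [hsum]
  have : (N : ℝ) ≠ 0 := by simp
  field_simp

/-- **Weak law of large numbers** for empirical measures. -/
theorem tendsto_measure_empirical_notMem (μ : ProbabilityMeasure X)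
    {U : Set (ProbabilityMeasure X)} (hU : U ∈ 𝓝 μ) :
    Tendsto (fun N : ℕ+ => (tensorPower μ N : Measure (Fin N → X)) {x | empirical N x ∉ U})
      atTop (𝓝 0) := by
  -- The sets that the empirical measure misses with vanishing probability form a filter. Its
  -- convergence to `μ` can be tested on integrals of single continuous functions, where Chebyshev's
  -- inequality applies.
  let F : Filter (ProbabilityMeasure X) :=
    { sets := {U | Tendsto (fun N : ℕ+ => (tensorPower μ N : Measure (Fin N → X))
        {x | empirical N x ∉ U}) atTop (𝓝 0)}
      univ_sets := by simp
      sets_of_superset := fun {U V} hU hUV =>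
        tendsto_of_tendsto_of_tendsto_of_le_of_le tendsto_const_nhds hU (fun _ => zero_le)
          fun N => measure_mono fun x hx hxU => hx (hUV hxU)
      inter_sets := fun {U V} hU hV => by
        have hUV := hU.add hV
        rw [add_zero] at hUV
        refine tendsto_of_tendsto_of_tendsto_of_le_of_le tendsto_const_nhds hUV
          (fun _ => zero_le) fun N => le_trans (measure_mono fun x hx => ?_) (measure_union_le _ _)
        by_contra hcon
        simp only [Set.mem_union, Set.mem_ofPred_eq, not_or, not_not] at hcon
        exact hx ⟨hcon.1, hcon.2⟩ }
  suffices h : Tendsto id F (𝓝 μ) from h hU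
  refine ProbabilityMeasure.tendsto_iff_forall_integral_tendsto.2 fun f => ?_
  refine Metric.tendsto_nhds.2 fun ε hε => ?_
  change Tendsto (fun N : ℕ+ => (tensorPower μ N : Measure (Fin N → X)) _) atTop (𝓝 0)
  have hlim : Tendsto (fun N : ℕ+ =>
      ENNReal.ofReal (Var[f; (μ : Measure X)] / ε ^ 2 * (N : ℝ)⁻¹)) atTop (𝓝 0) := by
    have := ENNReal.tendsto_ofReal (tendsto_pnat_inv.const_mul (Var[f; (μ : Measure X)] / ε ^ 2))
    simpa using this
  refine tendsto_of_tendsto_of_tendsto_of_le_of_le tendsto_const_nhds hlim (fun _ => zero_le)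
    fun N => le_trans (measure_mono fun x hx => ?_)
      (measure_average_deviation_le μ N f.toContinuousMap hε)
  simp only [id, Set.mem_ofPred_eq, not_lt, Real.dist_eq, integral_empirical] at hx ⊢
  exact hx

open Classical in
/-- Every probability measure is a limit of empirical measures. -/
theorem exists_tendsto_empirical (μ : ProbabilityMeasure X) :
    ∃ y : (N : ℕ+) → Fin N → X, Tendsto (fun N => empirical N (y N)) atTop (𝓝 μ) := by
  have : Nonempty X := μ.nonempty
  obtain ⟨z, hz, hzS⟩ := exists_tendsto_of_forall_eventually_nonempty
    (S := fun N => Set.range (empirical N)) (a := μ) fun U hU => by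
      -- Once the probability of missing `U` is below 1, some configuration has its empirical
      -- measure in `U`.
      filter_upwards [(tendsto_measure_empirical_notMem μ hU).eventually_lt_const zero_lt_one]
        with N hN
      by_contra hcon
      have : {x : Fin N → X | empirical N x ∉ U} = Set.univ :=
        Set.eq_univ_of_forall fun x hx => hcon ⟨_, ⟨x, rfl⟩, hx⟩
      simp [this] at hN
  have hex : ∀ N : ℕ+, ∃ y : Fin N → X,
      z N ∈ Set.range (empirical N) → empirical N y = z N := fun N =>
    if h : z N ∈ Set.range (empirical N) then ⟨h.choose, fun _ => h.choose_spec⟩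
    else ⟨Classical.arbitrary _, fun h' => absurd h' h⟩
  choose y hy using hex
  exact ⟨y, hz.congr' (hzS.mono fun N hN => (hy N hN).symm)⟩

end LawOfLargeNumbers

/-! ### Symmetrized configurations -/

section Symmetrization

variable {X : Type*} [MeasurableSpace X]

/-- The uniform law on the permutations of a configuration. -/
noncomputable def symmetrizedDirac {N : ℕ} (z : Fin N → X) : ProbabilityMeasure (Fin N → X) :=
  ⟨((N.factorial : ℕ) : ℝ≥0∞)⁻¹ • ∑ σ : Equiv.Perm (Fin N), Measure.dirac (z ∘ σ), ⟨by
    simp [Fintype.card_perm, ENNReal.inv_mul_cancel (Nat.cast_ne_zero.2 N.factorial_ne_zero)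
      (ENNReal.natCast_ne_top _)]⟩⟩

theorem coe_symmetrizedDirac {N : ℕ} (z : Fin N → X) :
    (symmetrizedDirac z : Measure (Fin N → X))
      = ((N.factorial : ℕ) : ℝ≥0∞)⁻¹ • ∑ σ : Equiv.Perm (Fin N), Measure.dirac (z ∘ σ) := rfl

theorem map_symmetrizedDirac {N : ℕ} (z : Fin N → X) {Z : Type*} [MeasurableSpace Z]
    {F : (Fin N → X) → Z} (hF : Measurable F) :
    (symmetrizedDirac z : Measure (Fin N → X)).map F = ((N.factorial : ℕ) : ℝ≥0∞)⁻¹ •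
      ∑ σ : Equiv.Perm (Fin N), Measure.dirac (F (z ∘ σ)) := by
  rw [coe_symmetrizedDirac, Measure.map_smul, ← Measure.mapₗ_apply_of_measurable hF, map_sum]
  simp only [Measure.mapₗ_apply_of_measurable hF, Measure.map_dirac' hF]

theorem isSymmetricLaw_symmetrizedDirac {N : ℕ} (z : Fin N → X) :
    IsSymmetricLaw (symmetrizedDirac z) := by
  intro τ
  have hτ : Measurable fun x : Fin N → X => x ∘ τ :=
    measurable_pi_lambda _ fun i => measurable_pi_apply _
  rw [map_symmetrizedDirac z hτ, coe_symmetrizedDirac]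
  congr 1
  exact Fintype.sum_equiv (Equiv.mulRight τ) _ _ fun σ => rfl

theorem map_symmetrizedDirac_of_symmetric {N : ℕ} (z : Fin N → X) {Z : Type*} [MeasurableSpace Z]
    {F : (Fin N → X) → Z} (hF : Measurable F)
    (hsymm : ∀ σ : Equiv.Perm (Fin N), F (z ∘ σ) = F z) :
    (symmetrizedDirac z : Measure (Fin N → X)).map F = Measure.dirac (F z) := by
  rw [map_symmetrizedDirac z hF]
  simp only [hsymm, Finset.sum_const, Finset.card_univ, Fintype.card_perm, Fintype.card_fin]
  rw [← Nat.cast_smul_eq_nsmul ℝ≥0∞, smul_smul, ENNReal.inv_mul_cancel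
    (Nat.cast_ne_zero.2 N.factorial_ne_zero) (ENNReal.natCast_ne_top _), one_smul]

theorem empirical_comp_perm {N : ℕ+} (z : Fin N → X) (σ : Equiv.Perm (Fin N)) :
    empirical N (z ∘ σ) = empirical N z := by
  refine Subtype.ext ?_
  change ((N : ℕ) : ℝ≥0∞)⁻¹ • ∑ i, Measure.dirac (z (σ i))
    = ((N : ℕ) : ℝ≥0∞)⁻¹ • ∑ i, Measure.dirac (z i)
  rw [Equiv.sum_comp σ fun i => Measure.dirac (z i)]

/-- Empirical measures forget the order of the points, so symmetrizing does not spread their law.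
This makes (H2), a statement on symmetric laws, applicable to single configurations. -/
theorem empiricalLaw_symmetrizedDirac {N : ℕ+} (z : Fin N → X) :
    empiricalLaw N (symmetrizedDirac z) = diracProba (empirical N z) :=
  Subtype.ext (map_symmetrizedDirac_of_symmetric z (measurable_empirical N)
    (empirical_comp_perm z))

theorem meanEnergy_symmetrizedDirac {H : (N : ℕ+) → (Fin N → X) → EReal} (hH : IsHamiltonian H)
    {N : ℕ+} (z : Fin N → X) :
    meanEnergy H N (symmetrizedDirac z) = H N z / (((N : ℕ) : ℝ) : EReal) := by
  have h := map_symmetrizedDirac_of_symmetric z (hH.measurable N) fun σ => hH.symmetric N σ z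
  have h' := integralEReal_map (μ := (symmetrizedDirac z : Measure (Fin N → X)))
    (hH.measurable N) measurable_id
  rw [h, integralEReal_dirac] at h'
  rw [meanEnergy]
  exact congrArg (· / (((N : ℕ) : ℝ) : EReal)) h'.symm

end Symmetrization

/-! ### Gamma-convergence from (H1) and (H2) -/

section GammaConvergence

variable {X : Type*} [TopologicalSpace X] [CompactSpace X] [TopologicalSpace.MetrizableSpace X]
  [MeasurableSpace X] [BorelSpace X] {H : (N : ℕ+) → (Fin N → X) → EReal}
  {E : ProbabilityMeasure X → EReal}

/-- A lower bound on `H^{(N)}(z)/N` with value in the reals gives a lower bound on `H^{(N)}(z)`. -/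
theorem coe_mul_le_of_le_div {N : ℕ+} {c : ℝ} {h : EReal}
    (hc : (c : EReal) ≤ h / (((N : ℕ) : ℝ) : EReal)) : ((N * c : ℝ) : EReal) ≤ h := by
  have hN : (0 : EReal) < (((N : ℕ) : ℝ) : EReal) := by exact_mod_cast N.pos
  rw [EReal.le_div_iff_mul_le hN (EReal.coe_ne_top _)] at hc
  rwa [mul_comm, EReal.coe_mul]

/-- The fallback `y` serves when `ν` is not an empirical measure; the infimum is then empty, with
value `⊤`. -/
theorem exists_config_scaledHamiltonian_le (hH : IsHamiltonian H) {N : ℕ+}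
    (ν : ProbabilityMeasure X) (y : Fin N → X) :
    ∃ z : Fin N → X, H N z / (((N : ℕ) : ℝ) : EReal) ≤ scaledHamiltonian H N ν ∧
      (empirical N z = ν ∨ z = y) := by
  by_cases h : ∃ z : Fin N → X, empirical N z = ν
  · obtain ⟨z, rfl⟩ := h
    exact ⟨z, (scaledHamiltonian_empirical hH N z).ge, Or.inl rfl⟩
  · refine ⟨y, ?_, Or.inr rfl⟩
    rw [scaledHamiltonian]
    exact le_iInf₂ fun z hz => absurd ⟨z, hz⟩ h

/-- (H2) applied to symmetrized configurations, whose empirical laws are Dirac masses converging to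
the one at `a`. -/
theorem le_liminf_scaledHamiltonian (hH : IsHamiltonian H) (h2 : H2 H E)
    (ν : ℕ+ → ProbabilityMeasure X) (a : ProbabilityMeasure X) (hν : Tendsto ν atTop (𝓝 a)) :
    E a ≤ liminf (fun N => scaledHamiltonian H N (ν N)) atTop := by
  obtain ⟨y, hy⟩ := exists_tendsto_empirical a
  choose z hz hz' using fun N : ℕ+ => exists_config_scaledHamiltonian_le hH (ν N) (y N)
  have hza : Tendsto (fun N => empirical N (z N)) atTop (𝓝 a) := by
    intro U hU
    refine mem_map.2 ?_
    filter_upwards [hy hU, hν hU] with N h1 h2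
    rcases hz' N with h | h
    · simpa [h] using h2
    · simpa [h] using h1
  have hlim := h2 (fun N => symmetrizedDirac (z N)) (diracProba a)
    (fun N => isSymmetricLaw_symmetrizedDirac _) (by
      simp_rw [empiricalLaw_symmetrizedDirac]
      exact (continuous_diracProba.tendsto a).comp hza)
  simp_rw [meanEnergy_symmetrizedDirac hH] at hlim
  have hE : integralEReal (diracProba a : Measure (ProbabilityMeasure X)) E = E a :=
    integralEReal_dirac a E
  rw [hE] at hlim
  exact hlim.trans (liminf_le_liminf (Eventually.of_forall hz))

/-- The functionals `H^{(N)}/N` are eventually bounded from below by a common constant. -/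
theorem exists_forall_le_scaledHamiltonian (hH : IsHamiltonian H) (hE : ∀ μ, E μ ≠ ⊥)
    (h2 : H2 H E) : ∃ C : ℝ, ∀ᶠ N in atTop, ∀ ν, (C : EReal) ≤ scaledHamiltonian H N ν := by
  let : MetricSpace (ProbabilityMeasure X) := TopologicalSpace.metrizableSpaceMetric _
  have hloc : ∀ a : ProbabilityMeasure X, ∃ U ∈ 𝓝 a, ∃ C : ℝ, ∀ᶠ N in atTop,
      ∀ ν ∈ U, (C : EReal) ≤ scaledHamiltonian H N ν := by
    intro a
    obtain ⟨C, -, hC⟩ := EReal.lt_iff_exists_real_btwn.1 (bot_lt_iff_ne_bot.2 (hE a))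
    have := eventually_lt_of_forall_liminf
      (fun ν hν => le_liminf_scaledHamiltonian hH h2 ν a hν) hC
    obtain ⟨P, hP, Q, hQ, hPQ⟩ := eventually_prod_iff.1 this
    exact ⟨{ν | Q ν}, hQ, C, hP.mono fun N hN ν hν => (hPQ hN hν).le⟩
  choose U hU C hC using hloc
  -- Finitely many of the local lower bounds suffice, by compactness of the space of probability
  -- measures.
  obtain ⟨t, ht⟩ := CompactSpace.elim_nhds_subcover U hU
  obtain ⟨B, hB⟩ := (t.image C).bddBelow
  refine ⟨B, ((Finset.eventually_all t).2 fun a _ => hC a).mono fun N hN ν => ?_⟩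
  have hν : ν ∈ ⋃ a ∈ t, U a := ht ▸ Set.mem_univ ν
  obtain ⟨a, hat, hνa⟩ := Set.mem_iUnion₂.1 hν
  exact (EReal.coe_le_coe_iff.2 (hB (Finset.mem_coe.2 (Finset.mem_image_of_mem C hat)))).trans
    (hN a hat ν hνa)

/-- If `H^{(N)}/N` is at least `C` everywhere and at least `C'` on `U`, then the mean energy of
`μ^{⊗N}` is almost at least `C'`. -/
theorem le_meanEnergy_of_le_on {N : ℕ+} {C C' : ℝ} {U : Set (ProbabilityMeasure X)}
    (hU : IsOpen U) (hC : ∀ ν, (C : EReal) ≤ scaledHamiltonian H N ν)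
    (hC' : ∀ ν ∈ U, (C' : EReal) ≤ scaledHamiltonian H N ν) (hH : IsHamiltonian H)
    (P : ProbabilityMeasure (Fin N → X)) :
    ((C' + (P : Measure (Fin N → X)).real {x | empirical N x ∉ U} * (C - C') : ℝ) : EReal)
      ≤ meanEnergy H N P := by
  classical
  have hS : MeasurableSet {x : Fin N → X | empirical N x ∉ U} :=
    measurable_empirical N hU.measurableSet.compl
  set S := {x : Fin N → X | empirical N x ∉ U} with hSdef
  -- A two-valued minorant of `H N`: `N * C` on `S` and `N * C'` off `S`.
  let g : (Fin N → X) → ℝ := fun x => N * C' + S.indicator (fun _ => N * (C - C')) x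
  have hg : Integrable g (P : Measure (Fin N → X)) :=
    (integrable_const _).add ((integrable_const _).indicator hS)
  have hle : ∀ x, (g x : EReal) ≤ H N x := by
    intro x
    by_cases hx : x ∈ S
    · have := coe_mul_le_of_le_div ((hC (empirical N x)).trans_eq (scaledHamiltonian_empirical hH N x))
      refine le_trans (le_of_eq ?_) this
      simp only [g, Set.indicator_of_mem hx]
      congr 1; ring
    · have hxU : empirical N x ∈ U := by simpa [hSdef] using hx
      have := coe_mul_le_of_le_div
        ((hC' (empirical N x) hxU).trans_eq (scaledHamiltonian_empirical hH N x))
      refine le_trans (le_of_eq ?_) this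
      simp only [g, Set.indicator_of_notMem hx, add_zero]
  have hint : ∫ x, g x ∂(P : Measure (Fin N → X))
      = (C' + (P : Measure (Fin N → X)).real S * (C - C')) * N := by
    simp only [g]
    rw [integral_add (integrable_const _) ((integrable_const _).indicator hS),
      integral_indicator_const _ hS]
    simp
    ring
  have hN : (0 : EReal) < (((N : ℕ) : ℝ) : EReal) := by exact_mod_cast N.pos
  rw [meanEnergy, EReal.le_div_iff_mul_le hN (EReal.coe_ne_top _), ← EReal.coe_mul, ← hint,
    ← integralEReal_coe hg]
  exact integralEReal_mono hle

/-- Otherwise the concentration of the product law of `a` on configurations with empirical measure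
in `U` would push the mean energy above its limit `E a`. -/
theorem eventually_exists_scaledHamiltonian_lt (hH : IsHamiltonian H) (hE : ∀ μ, E μ ≠ ⊥)
    (h2 : H2 H E) {a : ProbabilityMeasure X}
    (h1 : Tendsto (fun N : ℕ+ => meanEnergy H N (tensorPower a N)) atTop (𝓝 (E a)))
    {U : Set (ProbabilityMeasure X)} (hU : U ∈ 𝓝 a) {c : EReal} (hc : E a < c) :
    ∀ᶠ N in atTop, ∃ ν ∈ U, scaledHamiltonian H N ν < c := by
  obtain ⟨C, hC⟩ := exists_forall_le_scaledHamiltonian hH hE h2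
  obtain ⟨V, hVU, hVo, haV⟩ := mem_nhds_iff.1 hU
  -- Two real levels with `E a < e' < e < c`: `e` bounds the functional from below on `V`, and the
  -- gap down to `e'` absorbs the error from configurations outside `V`.
  obtain ⟨e, he, hec⟩ := EReal.lt_iff_exists_real_btwn.1 hc
  obtain ⟨e', he', hee'⟩ := EReal.lt_iff_exists_real_btwn.1 he
  have hreal : Tendsto (fun N : ℕ+ => e + (tensorPower a N : Measure (Fin N → X)).real
      {x | empirical N x ∉ V} * (C - e)) atTop (𝓝 e) := by
    have := (ENNReal.tendsto_toReal ENNReal.zero_ne_top).comp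
      (tendsto_measure_empirical_notMem a (hVo.mem_nhds haV))
    rw [ENNReal.toReal_zero] at this
    have h := (this.mul_const (C - e)).const_add e
    rw [zero_mul, add_zero] at h
    exact h
  filter_upwards [hC, h1.eventually_lt_const he',
    hreal.eventually_const_lt (EReal.coe_lt_coe_iff.1 hee')] with N hN hN1 hN2
  by_contra! hcon
  have := le_meanEnergy_of_le_on hVo hN
    (fun ν hν => hec.le.trans (hcon ν (hVU hν))) hH (tensorPower a N)
  exact absurd (this.trans_lt hN1) (not_lt.2 (EReal.coe_le_coe_iff.2 hN2.le))

theorem gammaConverges_scaledHamiltonian (hH : IsHamiltonian H) (hE : ∀ μ, E μ ≠ ⊥)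
    (h1 : ∀ μ, E μ < ⊤ →
      Tendsto (fun N : ℕ+ => meanEnergy H N (tensorPower μ N)) atTop (𝓝 (E μ)))
    (h2 : H2 H E) : GammaConverges (scaledHamiltonian H) E := by
  let : MetricSpace (ProbabilityMeasure X) := TopologicalSpace.metrizableSpaceMetric _
  refine ⟨fun ν a hν => le_liminf_scaledHamiltonian hH h2 ν a hν, fun a => ?_⟩
  have hlow : ∀ c < E a, ∀ᶠ p in atTop ×ˢ 𝓝 a, c < scaledHamiltonian H p.1 p.2 := fun c hc =>
    eventually_lt_of_forall_liminf (fun ν hν => le_liminf_scaledHamiltonian hH h2 ν a hν) hc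
  -- Applied to the graphs of the functionals near `(a, E a)`, diagonal extraction yields
  -- convergence of the points and of the values together.
  suffices hne : ∀ U ∈ 𝓝 (a, E a), ∀ᶠ N in atTop,
      (Set.range (fun ν => (ν, scaledHamiltonian H N ν)) ∩ U).Nonempty by
    obtain ⟨z, hz, hzS⟩ := exists_tendsto_of_forall_eventually_nonempty hne
    refine ⟨fun N => (z N).1, (continuous_fst.tendsto _).comp hz,
      ((continuous_snd.tendsto _).comp hz).congr' (hzS.mono ?_)⟩
    rintro N ⟨ν, hν⟩
    simp [← hν]
  intro U hU
  obtain ⟨V, hV, W, hW, hVW⟩ := mem_nhds_prod_iff.1 hU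
  suffices h : ∀ᶠ N in atTop, ∃ ν ∈ V, scaledHamiltonian H N ν ∈ W from h.mono
    fun N ⟨ν, hν, hνW⟩ => ⟨_, ⟨ν, rfl⟩, hVW ⟨hν, hνW⟩⟩
  -- If `E a = ⊤`, the lower bound at the point `a` itself suffices.
  rcases eq_or_ne (E a) ⊤ with htop | htop
  · obtain ⟨c, hc⟩ := EReal.mem_nhds_top_iff.1 (htop ▸ hW)
    filter_upwards [(hlow c (htop ▸ EReal.coe_lt_top c)).curry] with N hN
    exact ⟨a, mem_of_mem_nhds hV, hc hN.self_of_nhds⟩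
  · obtain ⟨c, d, ⟨hc, hd⟩, hcd⟩ := (mem_nhds_iff_exists_Ioo_subset'
      ⟨⊥, bot_lt_iff_ne_bot.2 (hE a)⟩ ⟨⊤, lt_top_iff_ne_top.2 htop⟩).1 hW
    obtain ⟨P, hP, Q, hQ, hPQ⟩ := eventually_prod_iff.1 (hlow c hc)
    filter_upwards [hP, eventually_exists_scaledHamiltonian_lt hH hE h2
      (h1 a (lt_top_iff_ne_top.2 htop)) (inter_mem hV hQ) hd] with N hN ⟨ν, hν, hνd⟩
    exact ⟨ν, hν.1, hcd ⟨hPQ hN hν.2, hνd⟩⟩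

end GammaConvergence

/-! ### Finite sums of extended reals -/

section ERealSums

theorem coe_finsetSum {ι : Type*} (s : Finset ι) (f : ι → ℝ) :
    ((∑ i ∈ s, f i : ℝ) : EReal) = ∑ i ∈ s, (f i : EReal) := by
  classical
  induction s using Finset.induction_on with
  | empty => simp
  | insert a s ha ih => rw [Finset.sum_insert ha, Finset.sum_insert ha, EReal.coe_add, ih]

theorem finsetSum_ne_bot {ι : Type*} (s : Finset ι) {f : ι → EReal} (h : ∀ i ∈ s, f i ≠ ⊥) :
    ∑ i ∈ s, f i ≠ ⊥ :=
  Finset.sum_induction f (· ≠ ⊥) (fun _ _ ha hb => EReal.add_ne_bot_iff.2 ⟨ha, hb⟩) (by simp) h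

theorem lt_top_of_finsetSum_lt_top {ι : Type*} {s : Finset ι} {f : ι → EReal}
    (h : ∀ i ∈ s, f i ≠ ⊥) (hs : ∑ i ∈ s, f i < ⊤) {i : ι} (hi : i ∈ s) : f i < ⊤ := by
  classical
  by_contra hcon
  rw [not_lt, top_le_iff] at hcon
  rw [← Finset.add_sum_erase s f hi, hcon, EReal.top_add_of_ne_bot
    (finsetSum_ne_bot _ fun j hj => h j (Finset.mem_of_mem_erase hj))] at hs
  exact lt_irrefl _ hs

/-- Addition is discontinuous only where `⊤` meets `⊥`, which limits different from `⊥` exclude. -/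
theorem tendsto_finsetSum_of_ne_bot {α ι : Type*} {l : Filter α} (s : Finset ι)
    {f : ι → α → EReal} {a : ι → EReal} (ha : ∀ i ∈ s, a i ≠ ⊥)
    (h : ∀ i ∈ s, Tendsto (f i) l (𝓝 (a i))) :
    Tendsto (fun x => ∑ i ∈ s, f i x) l (𝓝 (∑ i ∈ s, a i)) := by
  classical
  induction s using Finset.induction_on with
  | empty => simpa using tendsto_const_nhds
  | insert j s hj ih =>
    simp_rw [Finset.sum_insert hj]
    have hs : ∑ i ∈ s, a i ≠ ⊥ := finsetSum_ne_bot s fun i hi => ha i (Finset.mem_insert_of_mem hi)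
    refine (EReal.continuousAt_add (p := (_, _)) (Or.inr hs)
      (Or.inl (ha j (Finset.mem_insert_self j s)))).tendsto.comp
      ((h j (Finset.mem_insert_self j s)).prodMk_nhds (ih
        (fun i hi => ha i (Finset.mem_insert_of_mem hi))
        fun i hi => h i (Finset.mem_insert_of_mem hi)))

end ERealSums

/-! ### Continuous approximation of lower semicontinuous functions -/

section LowerSemicontinuous

variable {Y : Type*} [TopologicalSpace Y] [CompactSpace Y]

theorem exists_forall_coe_le_of_lowerSemicontinuous {W : Y → EReal} (hW : LowerSemicontinuous W)
    (hbot : ∀ y, W y ≠ ⊥) : ∃ c : ℝ, ∀ y, (c : EReal) ≤ W y := by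
  rcases isEmpty_or_nonempty Y with h | h
  · exact ⟨0, fun y => isEmptyElim y⟩
  obtain ⟨a, -, ha⟩ := LowerSemicontinuousOn.exists_isMinOn (s := (Set.univ : Set Y))
    Set.univ_nonempty isCompact_univ (hW.lowerSemicontinuousOn _)
  obtain ⟨c, -, hc⟩ := EReal.lt_iff_exists_real_btwn.1 (bot_lt_iff_ne_bot.2 (hbot a))
  exact ⟨c, fun y => hc.le.trans (ha (Set.mem_univ y))⟩

/-- A lower semicontinuous function on a compact metrizable space with values in `]-∞, ∞]` is the
limit of an increasing sequence of real-valued continuous functions. -/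
theorem exists_monotone_continuous_tendsto [TopologicalSpace.MetrizableSpace Y] {W : Y → EReal}
    (hW : LowerSemicontinuous W) (hbot : ∀ y, W y ≠ ⊥) :
    ∃ w : ℕ → C(Y, ℝ), Monotone (fun k y => w k y) ∧ (∀ k y, (w k y : EReal) ≤ W y) ∧
      ∀ y, Tendsto (fun k => (w k y : EReal)) atTop (𝓝 (W y)) := by
  rcases isEmpty_or_nonempty Y with hY | hY
  · exact ⟨fun _ => 0, fun _ _ _ => le_rfl, fun _ y => isEmptyElim y, fun y => isEmptyElim y⟩
  let : MetricSpace Y := TopologicalSpace.metrizableSpaceMetric Y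
  obtain ⟨c', hc'⟩ := exists_forall_coe_le_of_lowerSemicontinuous hW hbot
  -- With `c ≤ 0`, truncating at any level `k ≥ 0` preserves the lower bound.
  obtain ⟨c, hc0, hc⟩ : ∃ c : ℝ, c ≤ 0 ∧ ∀ y, (c : EReal) ≤ W y :=
    ⟨min c' 0, min_le_right _ _, fun y =>
      (EReal.coe_le_coe_iff.2 (min_le_left _ _)).trans (hc' y)⟩
  let V : ℕ → Y → ℝ := fun k y => (min (W y) ((k : ℝ) : EReal)).toReal
  have hcV' : ∀ (k : ℕ) y, (c : EReal) ≤ min (W y) ((k : ℝ) : EReal) := fun k y =>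
    le_min (hc y) (EReal.coe_le_coe_iff.2 (hc0.trans k.cast_nonneg))
  have hV : ∀ k y, (V k y : EReal) = min (W y) ((k : ℝ) : EReal) := fun k y =>
    EReal.coe_toReal (ne_top_of_le_ne_top (EReal.coe_ne_top _) (min_le_right _ _))
      (ne_bot_of_le_ne_bot (EReal.coe_ne_bot _) (hcV' k y))
  have hcV : ∀ k y, c ≤ V k y := fun k y => by
    rw [← EReal.coe_le_coe_iff, hV]; exact hcV' k y
  have hVmono : ∀ {j k : ℕ}, j ≤ k → ∀ y, V j y ≤ V k y := fun {j k} hjk y => by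
    rw [← EReal.coe_le_coe_iff, hV, hV]
    exact min_le_min le_rfl (EReal.coe_le_coe_iff.2 (Nat.cast_le.2 hjk))
  have hVk : ∀ (k : ℕ) x y, c ≤ V k y + k * dist x y := fun k x y =>
    (hcV k y).trans (le_add_of_nonneg_right (by positivity))
  have hbdd : ∀ (k : ℕ) x, BddBelow (Set.range fun y => V k y + k * dist x y) := fun k x =>
    ⟨c, by rintro _ ⟨y, rfl⟩; exact hVk k x y⟩
  -- Lipschitz regularization of the truncation of `W` at `k`, with slope `k`.
  let w : ℕ → Y → ℝ := fun k x => ⨅ y, V k y + k * dist x y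
  have hwlip : ∀ k : ℕ, LipschitzWith k (w k) := fun k => by
    refine LipschitzWith.of_le_add_mul _ fun x x' => ?_
    rw [← sub_le_iff_le_add]
    refine le_ciInf fun y => ?_
    rw [sub_le_iff_le_add]
    refine (ciInf_le (hbdd k x) y).trans ?_
    have := mul_le_mul_of_nonneg_left (dist_triangle x x' y) (Nat.cast_nonneg (α := ℝ) k)
    simp only [NNReal.coe_natCast]
    linarith
  have hwW : ∀ k y, (w k y : EReal) ≤ W y := fun k y => by
    have h1 : w k y ≤ V k y := (ciInf_le (hbdd k y) y).trans (by simp)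
    exact (EReal.coe_le_coe_iff.2 h1).trans ((hV k y).le.trans (min_le_left _ _))
  refine ⟨fun k => ⟨w k, (hwlip k).continuous⟩, fun j k hjk x => ?_, hwW, fun x => ?_⟩
  · refine le_ciInf fun y => (ciInf_le (hbdd j x) y).trans ?_
    exact add_le_add (hVmono hjk y)
      (mul_le_mul_of_nonneg_right (Nat.cast_le.2 hjk) dist_nonneg)
  · refine tendsto_order.2 ⟨fun b hb => ?_, fun b hb => Eventually.of_forall fun k =>
      (hwW k x).trans_lt hb⟩
    obtain ⟨b', hbb', hb'⟩ := EReal.lt_iff_exists_real_btwn.1 hb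
    obtain ⟨δ, hδ, hball⟩ := Metric.eventually_nhds_iff.1 (hW x b' hb')
    -- Within `δ` of `x`, `k ≥ b'` keeps the truncation above `b'`. Farther away, `V k y ≥ c` and
    -- the penalty is at least `k * δ ≥ b' - c`.
    obtain ⟨K, hK⟩ := exists_nat_ge (max b' ((b' - c) / δ))
    filter_upwards [eventually_ge_atTop K] with k hk
    have hkK : (K : ℝ) ≤ k := Nat.cast_le.2 hk
    refine hbb'.trans_le (EReal.coe_le_coe_iff.2 (le_ciInf fun y => ?_))
    rcases lt_or_ge (dist y x) δ with hy | hy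
    · have h1 : b' ≤ V k y := by
        rw [← EReal.coe_le_coe_iff, hV]
        exact le_min (hball hy).le (EReal.coe_le_coe_iff.2
          (((le_max_left _ _).trans hK).trans hkK))
      exact h1.trans (le_add_of_nonneg_right (by positivity))
    · have h1 : (b' - c) / δ ≤ k := ((le_max_right _ _).trans hK).trans hkK
      rw [div_le_iff₀ hδ] at h1
      have h2 : (k : ℝ) * δ ≤ k * dist x y := by
        rw [dist_comm]; exact mul_le_mul_of_nonneg_left hy (Nat.cast_nonneg k)
      linarith [hcV k y]

end LowerSemicontinuous

/-! ### Tensor powers and multi-indices -/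

section TensorPowers

theorem measurePreserving_comp_embedding {X ι κ : Type*} [MeasurableSpace X] [Fintype ι] [Fintype κ]
    (μ : Measure X) [IsProbabilityMeasure μ] (I : ι ↪ κ) :
    MeasurePreserving (fun x : κ → X => fun k => x (I k)) (Measure.pi fun _ => μ)
      (Measure.pi fun _ => μ) := by
  have hmeas : Measurable fun x : κ → X => fun k => x (I k) :=
    measurable_pi_lambda _ fun k => measurable_pi_apply _
  refine ⟨hmeas, (Measure.pi_eq fun s hs => ?_).symm⟩
  rw [Measure.map_apply hmeas (MeasurableSet.univ_pi hs)]
  -- Since `I` is injective, boxes pull back to boxes, whose sides outside the range of `I` are the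
  -- whole space and have mass 1.
  have hpre : (fun x : κ → X => fun k => x (I k)) ⁻¹' Set.univ.pi s
      = Set.univ.pi (Function.extend I s fun _ => Set.univ) := by
    ext x
    simp only [Set.mem_preimage, Set.mem_univ_pi]
    refine ⟨fun h i => ?_, fun h k => by simpa [I.injective.extend_apply] using h (I k)⟩
    by_cases hi : ∃ k, I k = i
    · obtain ⟨k, rfl⟩ := hi
      simpa [I.injective.extend_apply] using h k
    · simp [Function.extend_apply' _ _ _ hi]
  rw [hpre, Measure.pi_pi]
  refine (Fintype.prod_of_injective I I.injective _ _ (fun i hi => ?_) fun k => ?_).symm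
  · rw [Function.extend_apply' _ _ _ hi, measure_univ]
  · rw [I.injective.extend_apply]

theorem tensorPower_empirical {X : Type*} [MeasurableSpace X] {N : ℕ+} (x : Fin N → X) (m : ℕ) :
    (tensorPower (empirical N x) m : Measure (Fin m → X))
      = (((N : ℕ) : ℝ≥0∞)⁻¹) ^ m • ∑ I : Fin m → Fin N, Measure.dirac (fun k => x (I k)) := by
  classical
  refine Measure.pi_eq fun s hs => ?_
  have h1 : ∀ k, ((empirical N x : ProbabilityMeasure X) : Measure X) (s k)
      = ((N : ℕ) : ℝ≥0∞)⁻¹ * ∑ i : Fin N, (s k).indicator 1 (x i) := fun k => by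
    simp [empirical, Measure.dirac_apply' _ (hs k)]
  simp_rw [h1, Finset.prod_mul_distrib, Finset.prod_univ_sum]
  simp only [Measure.smul_apply, Measure.finsetSum_apply, smul_eq_mul, Finset.prod_const,
    Finset.card_univ, Fintype.card_fin, Fintype.piFinset_univ,
    Measure.dirac_apply' _ (MeasurableSet.univ_pi hs)]
  congr 1
  refine Finset.sum_congr rfl fun I _ => ?_
  simp only [Set.indicator_apply, Set.mem_univ_pi, Pi.one_apply, Finset.prod_ite_zero,
    Finset.mem_univ, true_implies, Finset.prod_const_one]

theorem integral_tensorPower_empirical {X : Type*} [MeasurableSpace X] [MeasurableSingletonClass X]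
    {N : ℕ+} (x : Fin N → X) (m : ℕ) (w : (Fin m → X) → ℝ) :
    ∫ y, w y ∂(tensorPower (empirical N x) m : Measure (Fin m → X))
      = ((N : ℝ) ^ m)⁻¹ * ∑ I : Fin m → Fin N, w (fun k => x (I k)) := by
  rw [tensorPower_empirical, integral_smul_measure,
    integral_finsetSum_measure fun I _ => integrable_dirac (by simp)]
  simp

/-- The difference is the sum over the multi-indices with a repetition, and the constant is their
number times `B`. -/
theorem abs_sum_functions_sub_sum_embeddings_le {m N : ℕ} {f : (Fin m → Fin N) → ℝ} {B : ℝ}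
    (hf : ∀ I, |f I| ≤ B) :
    |∑ I, f I - ∑ I : Fin m ↪ Fin N, f I| ≤ ((N : ℝ) ^ m - N.descFactorial m) * B := by
  classical
  have hinj : ∑ I : Fin m ↪ Fin N, f I
      = ∑ I ∈ Finset.univ.filter (fun I : Fin m → Fin N => Function.Injective I), f I := by
    rw [← Finset.sum_subtype_eq_sum_filter]
    simp only [Finset.subtype_univ]
    exact (Fintype.sum_equiv (Equiv.subtypeInjectiveEquivEmbedding (Fin m) (Fin N)) _ _
      fun I => rfl).symm
  have hcard : ((Finset.univ.filter fun I : Fin m → Fin N => ¬ Function.Injective I).card : ℝ)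
      = (N : ℝ) ^ m - N.descFactorial m := by
    have h1 := Finset.card_filter_add_card_filter_not (s := (Finset.univ : Finset (Fin m → Fin N)))
      (fun I => Function.Injective I)
    have h2 : (Finset.univ.filter fun I : Fin m → Fin N => Function.Injective I).card
        = N.descFactorial m := by
      rw [← Fintype.card_subtype, Fintype.card_congr (Equiv.subtypeInjectiveEquivEmbedding _ _),
        Fintype.card_embedding_eq]
      simp
    rw [h2] at h1
    simp only [Finset.card_univ, Fintype.card_pi, Fintype.card_fin, Finset.prod_const] at h1
    rw [eq_sub_iff_add_eq, add_comm]
    exact_mod_cast h1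
  rw [hinj, ← Finset.sum_filter_add_sum_filter_not Finset.univ
    (fun I : Fin m → Fin N => Function.Injective I) f, add_sub_cancel_left, ← hcard,
    ← nsmul_eq_mul]
  exact (Finset.abs_sum_le_sum_abs _ _).trans (Finset.sum_le_card_nsmul _ _ _ fun I _ => hf I)

theorem tendsto_descFactorial_div_pow (m : ℕ) :
    Tendsto (fun N : ℕ+ => ((N : ℕ).descFactorial m : ℝ) / (N : ℝ) ^ m) atTop (𝓝 1) := by
  have h := (Asymptotics.isEquivalent_iff_tendsto_one (by
    filter_upwards [eventually_gt_atTop 0] with n hn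
    positivity)).1 (isEquivalent_descFactorial m)
  exact h.comp tendsto_PNat_val_atTop_atTop

theorem continuous_integral_tensorPower {X : Type*} [TopologicalSpace X] [CompactSpace X]
    [TopologicalSpace.MetrizableSpace X] [MeasurableSpace X] [BorelSpace X] {m : ℕ}
    (w : C(Fin m → X, ℝ)) :
    Continuous fun μ : ProbabilityMeasure X =>
      ∫ y, w y ∂(tensorPower μ m : Measure (Fin m → X)) := by
  have : SecondCountableTopology X := by
    let : MetricSpace X := TopologicalSpace.metrizableSpaceMetric X
    infer_instance
  have hpi : Continuous fun μ : ProbabilityMeasure X => tensorPower μ m :=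
    ProbabilityMeasure.continuous_pi.comp (continuous_pi fun _ => continuous_id)
  exact (ProbabilityMeasure.continuous_integral_continuousMap w).comp hpi

end TensorPowers

/-! ### Finite order mean field Hamiltonians -/

section MeanField

variable {X : Type*}

theorem meanFieldHamiltonian_coe {M : ℕ} (w : (m : ℕ) → (Fin m → X) → ℝ) (N : ℕ+)
    (x : Fin N → X) :
    meanFieldHamiltonian M (fun m y => (w m y : EReal)) N x
      = ((N * ∑ m ∈ Finset.Icc 1 M, ((N : ℝ) ^ m)⁻¹ *
          ∑ I : Fin m ↪ Fin N, w m (fun k => x (I k)) : ℝ) : EReal) := by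
  rw [meanFieldHamiltonian, Finset.mul_sum, coe_finsetSum]
  refine Finset.sum_congr rfl fun m hm => ?_
  rw [← coe_finsetSum, ← EReal.coe_mul, EReal.coe_eq_coe_iff]
  -- As `m ≥ 1`, the natural subtraction in `m - 1` is genuine and N^{-(m-1)} = N · N^{-m}.
  obtain ⟨j, rfl⟩ : ∃ j, m = j + 1 := ⟨m - 1, by have := (Finset.mem_Icc.1 hm).1; omega⟩
  have : (N : ℝ) ≠ 0 := by simp
  rw [Nat.add_sub_cancel, pow_succ]
  field_simp

theorem meanFieldHamiltonian_mono {M : ℕ} {W W' : (m : ℕ) → (Fin m → X) → EReal}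
    (h : ∀ m ∈ Finset.Icc 1 M, W m ≤ W' m) (N : ℕ+) :
    meanFieldHamiltonian M W N ≤ meanFieldHamiltonian M W' N := by
  refine fun x => Finset.sum_le_sum fun m hm => ?_
  exact mul_le_mul_of_nonneg_left (Finset.sum_le_sum fun I _ => h m hm _)
    (EReal.coe_nonneg.2 (by positivity))

theorem integralEReal_tensorPower_ne_bot [TopologicalSpace X] [CompactSpace X] [MeasurableSpace X]
    {m : ℕ} {V : (Fin m → X) → EReal}
    (hV : LowerSemicontinuous V) (hbot : ∀ x, V x ≠ ⊥) (μ : ProbabilityMeasure X) :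
    integralEReal (tensorPower μ m : Measure (Fin m → X)) V ≠ ⊥ := by
  obtain ⟨c, hc⟩ := exists_forall_coe_le_of_lowerSemicontinuous hV hbot
  exact ne_bot_of_le_ne_bot (EReal.coe_ne_bot c) (le_integralEReal_of_forall_le hc)

theorem meanFieldEnergy_ne_bot [TopologicalSpace X] [CompactSpace X] [MeasurableSpace X]
    {M : ℕ} {W : (m : ℕ) → (Fin m → X) → EReal}
    (hW : ∀ m ∈ Finset.Icc 1 M, LowerSemicontinuous (W m))
    (hbot : ∀ m ∈ Finset.Icc 1 M, ∀ x, W m x ≠ ⊥) (μ : ProbabilityMeasure X) :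
    meanFieldEnergy M W μ ≠ ⊥ :=
  finsetSum_ne_bot _ fun m hm => integralEReal_tensorPower_ne_bot (hW m hm) (hbot m hm) μ

variable [TopologicalSpace X] [CompactSpace X] [TopologicalSpace.MetrizableSpace X]
  [MeasurableSpace X] [BorelSpace X]

/-- For continuous interactions the mean field Hamiltonian per particle is uniformly close to the
mean field energy of the empirical measure. -/
theorem abs_meanField_sub_energy_empirical_le {M : ℕ} (w : (m : ℕ) → C(Fin m → X, ℝ)) {N : ℕ+}
    (x : Fin N → X) :
    |∑ m ∈ Finset.Icc 1 M, ∫ y, w m y ∂(tensorPower (empirical N x) m : Measure (Fin m → X))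
      - ∑ m ∈ Finset.Icc 1 M, ((N : ℝ) ^ m)⁻¹ * ∑ I : Fin m ↪ Fin N, w m (fun k => x (I k))|
      ≤ ∑ m ∈ Finset.Icc 1 M, (1 - ((N : ℕ).descFactorial m : ℝ) / (N : ℝ) ^ m) * ‖w m‖ := by
  rw [← Finset.sum_sub_distrib]
  refine (Finset.abs_sum_le_sum_abs _ _).trans (Finset.sum_le_sum fun m _ => ?_)
  have hN : (0 : ℝ) < (N : ℝ) ^ m := by positivity
  rw [integral_tensorPower_empirical, ← mul_sub, abs_mul, abs_of_pos (inv_pos.2 hN)]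
  refine (mul_le_mul_of_nonneg_left (abs_sum_functions_sub_sum_embeddings_le
    (f := fun I => w m fun k => x (I k)) fun I => (w m).norm_coe_le_norm _)
    (inv_pos.2 hN).le).trans (le_of_eq ?_)
  field_simp

/-- The continuous minorants give H^{(N)} ≥ N (G(δ_N) - r_N) pointwise, where `G` is weakly
continuous and `r` tends to 0. Weak convergence of the empirical laws then passes to the limit in
the integral of `G`. -/
theorem le_liminf_meanEnergy_of_continuous {M : ℕ} {W : (m : ℕ) → (Fin m → X) → EReal}
    (w : (m : ℕ) → C(Fin m → X, ℝ)) (hw : ∀ m ∈ Finset.Icc 1 M, ∀ y, (w m y : EReal) ≤ W m y)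
    {μ : (N : ℕ+) → ProbabilityMeasure (Fin N → X)} {Γ : ProbabilityMeasure (ProbabilityMeasure X)}
    (hΓ : Tendsto (fun N => empiricalLaw N (μ N)) atTop (𝓝 Γ)) :
    ((∫ ν, ∑ m ∈ Finset.Icc 1 M, ∫ y, w m y ∂(tensorPower ν m : Measure (Fin m → X))
        ∂(Γ : Measure (ProbabilityMeasure X)) : ℝ) : EReal)
      ≤ liminf (fun N => meanEnergy (meanFieldHamiltonian M W) N (μ N)) atTop := by
  let G : C(ProbabilityMeasure X, ℝ) :=
    ⟨fun ν => ∑ m ∈ Finset.Icc 1 M, ∫ y, w m y ∂(tensorPower ν m : Measure (Fin m → X)),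
      continuous_finsetSum _ fun m _ => continuous_integral_tensorPower (w m)⟩
  let r : ℕ+ → ℝ := fun N =>
    ∑ m ∈ Finset.Icc 1 M, (1 - ((N : ℕ).descFactorial m : ℝ) / (N : ℝ) ^ m) * ‖w m‖
  have hr : Tendsto r atTop (𝓝 0) := by
    have := tendsto_finsetSum (Finset.Icc 1 M) fun m _ =>
      ((tendsto_descFactorial_div_pow m).const_sub 1).mul_const ‖w m‖
    simpa [r] using this
  have hG : Tendsto (fun N => ∫ ν, G ν ∂(empiricalLaw N (μ N) : Measure (ProbabilityMeasure X)))
      atTop (𝓝 (∫ ν, G ν ∂(Γ : Measure (ProbabilityMeasure X)))) :=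
    ((ProbabilityMeasure.continuous_integral_continuousMap G).tendsto Γ).comp hΓ
  have hlim := hG.sub hr
  rw [sub_zero, ← EReal.tendsto_coe] at hlim
  refine hlim.liminf_eq.ge.trans (liminf_le_liminf (Eventually.of_forall fun N => ?_))
  have hN : (0 : EReal) < (((N : ℕ) : ℝ) : EReal) := by exact_mod_cast N.pos
  have hemp : Integrable (fun x => G (empirical N x)) (μ N : Measure (Fin N → X)) :=
    Integrable.of_bound
      ((G.continuous.measurable.comp (measurable_empirical N)).aestronglyMeasurable) ‖G‖
      (ae_of_all _ fun x => G.norm_coe_le_norm _)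
  have hmap : ∫ ν, G ν ∂(empiricalLaw N (μ N) : Measure (ProbabilityMeasure X))
      = ∫ x, G (empirical N x) ∂(μ N : Measure (Fin N → X)) :=
    integral_map (measurable_empirical N).aemeasurable
      G.continuous.measurable.aestronglyMeasurable
  have hg : Integrable (fun x => (G (empirical N x) - r N) * N) (μ N : Measure (Fin N → X)) :=
    (hemp.sub (integrable_const _)).mul_const _
  rw [meanEnergy, EReal.le_div_iff_mul_le hN (EReal.coe_ne_top _), ← EReal.coe_mul, hmap]
  have hint : ∫ x, (G (empirical N x) - r N) * N ∂(μ N : Measure (Fin N → X))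
      = (∫ x, G (empirical N x) ∂(μ N : Measure (Fin N → X)) - r N) * N := by
    rw [integral_mul_const, integral_sub hemp (integrable_const _)]
    simp
  rw [← hint, ← integralEReal_coe hg]
  refine integralEReal_mono fun x => le_trans ?_ (meanFieldHamiltonian_mono
    (W := fun m y => (w m y : EReal)) hw N x)
  rw [meanFieldHamiltonian_coe (fun m y => w m y), EReal.coe_le_coe_iff, mul_comm]
  refine mul_le_mul_of_nonneg_left ?_ (Nat.cast_nonneg _)
  have := (abs_le.1 (abs_meanField_sub_energy_empirical_le (M := M) w x)).2
  simp only [G, ContinuousMap.coe_mk, r]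
  linarith

variable {M : ℕ} {W : (m : ℕ) → (Fin m → X) → EReal}

theorem measurable_of_lowerSemicontinuous_pi {m : ℕ} {V : (Fin m → X) → EReal}
    (hV : LowerSemicontinuous V) : Measurable V := by
  have : SecondCountableTopology X := by
    let : MetricSpace X := TopologicalSpace.metrizableSpaceMetric X
    infer_instance
  exact hV.measurable

/-- Monotone convergence is used twice along the approximating interactions: for each ν on X^m, so
that the continuous energies increase to `meanFieldEnergy M W`, and then against Γ. -/
theorem h2_meanField (hW : ∀ m ∈ Finset.Icc 1 M, LowerSemicontinuous (W m))
    (hbot : ∀ m ∈ Finset.Icc 1 M, ∀ x, W m x ≠ ⊥) :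
    H2 (meanFieldHamiltonian M W) (meanFieldEnergy M W) := by
  intro μ Γ _ hΓ
  have hex : ∀ m, ∃ w : ℕ → C(Fin m → X, ℝ), m ∈ Finset.Icc 1 M →
      Monotone (fun k y => w k y) ∧ (∀ k y, (w k y : EReal) ≤ W m y) ∧
      ∀ y, Tendsto (fun k => (w k y : EReal)) atTop (𝓝 (W m y)) := by
    intro m
    by_cases hm : m ∈ Finset.Icc 1 M
    · obtain ⟨w, hw⟩ := exists_monotone_continuous_tendsto (hW m hm) (hbot m hm)
      exact ⟨w, fun _ => hw⟩
    · exact ⟨fun _ => 0, fun h => absurd h hm⟩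
  choose w hw using hex
  have : SecondCountableTopology X := by
    let : MetricSpace X := TopologicalSpace.metrizableSpaceMetric X
    infer_instance
  have hint : ∀ m k (ν : ProbabilityMeasure X),
      Integrable (w m k) (tensorPower ν m : Measure (Fin m → X)) := fun m k ν =>
    (w m k).continuous.integrable_of_hasCompactSupport (HasCompactSupport.of_compactSpace _)
  let g : ℕ → ProbabilityMeasure X → ℝ := fun k ν =>
    ∑ m ∈ Finset.Icc 1 M, ∫ y, w m k y ∂(tensorPower ν m : Measure (Fin m → X))
  have hgc : ∀ k, Continuous (g k) := fun k =>
    continuous_finsetSum _ fun m _ => continuous_integral_tensorPower (w m k)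
  refine le_of_tendsto' (tendsto_integralEReal_of_monotone (g := g)
    (fun k => (hgc k).integrable_of_hasCompactSupport (HasCompactSupport.of_compactSpace _))
    (fun k => (hgc k).measurable) (fun j k hjk ν => ?_) fun ν => ?_)
    fun k => le_liminf_meanEnergy_of_continuous (fun m => w m k) (fun m hm => (hw m hm).2.1 k) hΓ
  · exact Finset.sum_le_sum fun m hm => integral_mono (hint m j ν) (hint m k ν)
      ((hw m hm).1 hjk)
  · simp only [g, coe_finsetSum]
    exact tendsto_finsetSum_of_ne_bot _
      (fun m hm => integralEReal_tensorPower_ne_bot (hW m hm) (hbot m hm) ν) fun m hm =>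
      tendsto_integralEReal_of_monotone (fun k => hint m k ν)
        (fun k => (w m k).continuous.measurable) (hw m hm).1 (hw m hm).2.2

/-- Under μ^{⊗N} the points selected by an injective multi-index have law μ^{⊗m}. The mean energy is
thus an explicit finite sum, with weights N(N-1)⋯(N-m+1)/N^m tending to 1. -/
theorem tendsto_meanEnergy_meanField (hW : ∀ m ∈ Finset.Icc 1 M, LowerSemicontinuous (W m))
    (hbot : ∀ m ∈ Finset.Icc 1 M, ∀ x, W m x ≠ ⊥) {μ : ProbabilityMeasure X}
    (hμ : meanFieldEnergy M W μ < ⊤) :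
    Tendsto (fun N : ℕ+ => meanEnergy (meanFieldHamiltonian M W) N (tensorPower μ N)) atTop
      (𝓝 (meanFieldEnergy M W μ)) := by
  let w : (m : ℕ) → (Fin m → X) → ℝ := fun m y => (W m y).toReal
  -- No term of the energy is `⊥`, so a finite sum forces each term to be finite, and `W m` is
  -- almost everywhere real.
  have hw : ∀ m ∈ Finset.Icc 1 M, Integrable (w m) (tensorPower μ m : Measure (Fin m → X)) ∧
      W m =ᵐ[(tensorPower μ m : Measure (Fin m → X))] fun y => (w m y : EReal) := by
    intro m hm
    obtain ⟨c, hc⟩ := exists_forall_coe_le_of_lowerSemicontinuous (hW m hm) (hbot m hm)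
    exact integrable_toReal_of_integralEReal_lt_top
      (measurable_of_lowerSemicontinuous_pi (hW m hm)) hc (lt_top_of_finsetSum_lt_top
        (fun j hj => integralEReal_tensorPower_ne_bot (hW j hj) (hbot j hj) μ) hμ hm)
  have hE : meanFieldEnergy M W μ
      = ((∑ m ∈ Finset.Icc 1 M, ∫ y, w m y ∂(tensorPower μ m : Measure (Fin m → X)) : ℝ) : EReal) := by
    rw [coe_finsetSum]
    refine Finset.sum_congr rfl fun m hm => ?_
    rw [integralEReal_congr_ae (hw m hm).2, integralEReal_coe (hw m hm).1]
  have hI : ∀ (N : ℕ+) (m : ℕ) (I : Fin m ↪ Fin N),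
      MeasurePreserving (fun x : Fin N → X => fun k => x (I k))
        (tensorPower μ N : Measure (Fin N → X)) (tensorPower μ m : Measure (Fin m → X)) :=
    fun N m I => measurePreserving_comp_embedding (μ : Measure X) I
  have hN : ∀ N : ℕ+, meanEnergy (meanFieldHamiltonian M W) N (tensorPower μ N)
      = ((∑ m ∈ Finset.Icc 1 M, ((N : ℕ).descFactorial m : ℝ) / (N : ℝ) ^ m *
          ∫ y, w m y ∂(tensorPower μ m : Measure (Fin m → X)) : ℝ) : EReal) := by
    intro N
    have hae : meanFieldHamiltonian M W N =ᵐ[(tensorPower μ N : Measure (Fin N → X))]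
        fun x => ((N * ∑ m ∈ Finset.Icc 1 M, ((N : ℝ) ^ m)⁻¹ *
          ∑ I : Fin m ↪ Fin N, w m (fun k => x (I k)) : ℝ) : EReal) := by
      have hall : ∀ᵐ x ∂(tensorPower μ N : Measure (Fin N → X)), ∀ m ∈ Finset.Icc 1 M,
          ∀ I : Fin m ↪ Fin N, W m (fun k => x (I k)) = (w m (fun k => x (I k)) : EReal) :=
        (Finset.eventually_all _).2 fun m hm => eventually_all.2 fun I =>
          (hI N m I).quasiMeasurePreserving.ae (hw m hm).2
      filter_upwards [hall] with x hx
      rw [← meanFieldHamiltonian_coe]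
      exact Finset.sum_congr rfl fun m hm => by
        rw [Finset.sum_congr rfl fun I _ => hx m hm I]
    have hint : ∀ m ∈ Finset.Icc 1 M, ∀ I : Fin m ↪ Fin N,
        Integrable (fun x : Fin N → X => w m (fun k => x (I k)))
          (tensorPower μ N : Measure (Fin N → X)) := fun m hm I =>
      (hI N m I).integrable_comp_of_integrable (hw m hm).1
    have hval : ∀ m ∈ Finset.Icc 1 M, ∀ I : Fin m ↪ Fin N,
        ∫ x, w m (fun k => x (I k)) ∂(tensorPower μ N : Measure (Fin N → X))
          = ∫ y, w m y ∂(tensorPower μ m : Measure (Fin m → X)) := fun m hm I => by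
      rw [← (hI N m I).map_eq, integral_map (hI N m I).measurable.aemeasurable
        (by rw [(hI N m I).map_eq]; exact (hw m hm).1.aestronglyMeasurable)]
    rw [meanEnergy, integralEReal_congr_ae hae, integralEReal_coe
      ((integrable_finsetSum _ fun m hm =>
        (integrable_finsetSum _ fun I _ => hint m hm I).const_mul _).const_mul _),
      ← EReal.coe_div, EReal.coe_eq_coe_iff, integral_const_mul,
      integral_finsetSum _ fun m hm =>
        (integrable_finsetSum _ fun I _ => hint m hm I).const_mul _,
      mul_div_cancel_left₀ _ (by simp)]
    refine Finset.sum_congr rfl fun m hm => ?_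
    rw [integral_const_mul, integral_finsetSum _ fun I _ => hint m hm I,
      Finset.sum_congr rfl fun I _ => hval m hm I]
    simp only [Finset.sum_const, Finset.card_univ, Fintype.card_embedding_eq, Fintype.card_fin,
      nsmul_eq_mul]
    ring
  simp_rw [hN, hE]
  refine EReal.tendsto_coe.2 ?_
  have := tendsto_finsetSum (Finset.Icc 1 M) fun m _ =>
    (tendsto_descFactorial_div_pow m).mul_const
      (∫ y, w m y ∂(tensorPower μ m : Measure (Fin m → X)))
  simpa using this

theorem isHamiltonian_meanField (hW : ∀ m ∈ Finset.Icc 1 M, LowerSemicontinuous (W m))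
    (hbot : ∀ m ∈ Finset.Icc 1 M, ∀ x, W m x ≠ ⊥) :
    IsHamiltonian (meanFieldHamiltonian M W) where
  ne_bot N x := finsetSum_ne_bot _ fun m hm => by
    have h1 := finsetSum_ne_bot (Finset.univ : Finset (Fin m ↪ Fin N))
      (f := fun I => W m (fun k => x (I k))) fun I _ => hbot m hm _
    have h2 : (0 : ℝ) < (((N : ℕ) : ℝ) ^ (m - 1))⁻¹ := by positivity
    intro hcon
    rcases EReal.mul_eq_bot _ _ |>.1 hcon with h | h | h | h
    · exact EReal.coe_ne_bot _ h.1
    · exact h1 h.2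
    · exact EReal.coe_ne_top _ h.1
    · exact absurd h.1 (not_lt.2 (EReal.coe_nonneg.2 h2.le))
  symmetric N σ x := Finset.sum_congr rfl fun m _ => by
    congr 1
    exact Fintype.sum_equiv (Equiv.embeddingCongr (Equiv.refl _) σ) _ _ fun I => rfl
  measurable N := Finset.measurable_fun_sum _ fun m hm => measurable_const.mul
    (Finset.measurable_fun_sum _ fun I _ =>
      (measurable_of_lowerSemicontinuous_pi (hW m hm)).comp
        (measurable_pi_lambda _ fun k => measurable_pi_apply _))

end MeanField

end MeanEnergy

theorem corollary1p6 {X : Type*} [TopologicalSpace X] [CompactSpace X]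
    [TopologicalSpace.MetrizableSpace X] [MeasurableSpace X] [BorelSpace X]
    (μ₀ : ProbabilityMeasure X) :
    (∀ (H : (N : ℕ+) → (Fin N → X) → EReal) (E : ProbabilityMeasure X → EReal),
      MeanEnergy.IsHamiltonian H →
      MeanEnergy.H1 H E μ₀ → MeanEnergy.H2 H E → MeanEnergy.H3 E μ₀ →
      MeanEnergy.GammaConverges (MeanEnergy.scaledHamiltonian H) E) ∧
    (∀ (M : ℕ) (W : (m : ℕ) → (Fin m → X) → EReal),
      (∀ m ∈ Finset.Icc 1 M, LowerSemicontinuous (W m) ∧ (∀ x, W m x ≠ ⊥) ∧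
        ∀ (σ : Equiv.Perm (Fin m)) (x : Fin m → X), W m (x ∘ σ) = W m x) →
      (MeanEnergy.meanFieldEnergy M W μ₀ < ⊤ →
        MeanEnergy.H1 (MeanEnergy.meanFieldHamiltonian M W) (MeanEnergy.meanFieldEnergy M W) μ₀) ∧
      MeanEnergy.H2 (MeanEnergy.meanFieldHamiltonian M W) (MeanEnergy.meanFieldEnergy M W) ∧
      (MeanEnergy.H3 (MeanEnergy.meanFieldEnergy M W) μ₀ →
        MeanEnergy.GammaConverges
          (MeanEnergy.scaledHamiltonian (MeanEnergy.meanFieldHamiltonian M W))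
          (MeanEnergy.meanFieldEnergy M W))) := by
  refine ⟨fun H E hH h1 h2 _ =>
    MeanEnergy.gammaConverges_scaledHamiltonian hH h1.ne_bot h1.tendsto h2, fun M W hW' => ?_⟩
  have hW : ∀ m ∈ Finset.Icc 1 M, LowerSemicontinuous (W m) := fun m hm => (hW' m hm).1
  have hbot : ∀ m ∈ Finset.Icc 1 M, ∀ x, W m x ≠ ⊥ := fun m hm => (hW' m hm).2.1
  have htendsto := fun (μ : ProbabilityMeasure X) (hμ : MeanEnergy.meanFieldEnergy M W μ < ⊤) =>
    MeanEnergy.tendsto_meanEnergy_meanField hW hbot hμ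
  have hE := MeanEnergy.meanFieldEnergy_ne_bot hW hbot
  exact ⟨fun h0 => ⟨hE, htendsto, h0⟩, MeanEnergy.h2_meanField hW hbot, fun _ =>
    MeanEnergy.gammaConverges_scaledHamiltonian (MeanEnergy.isHamiltonian_meanField hW hbot) hE
      htendsto (MeanEnergy.h2_meanField hW hbot)⟩
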